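/- A nontrivial unital (not necessarily commutative) ring $R$ is called \emph{fadelian} if for all $x \in R$ and all nonzero $a \in R$ there exist $b, c \in R$ with $x = ab + ca$. A \emph{differentially closed field} is a field $k$ of characteristic $0$ with a derivation $\delta$ such that, for all differential polynomials $f, g$ in one variable over $k$ (polynomials in $X, X', X'', \dots$) with $g \neq 0$ and $\operatorname{ord} f > \operatorname{ord} g$, there is $x \in k$ with $f(x) = 0$ and $g(x) \neq 0$; here $\operatorname{ord} f$ is the largest $i$ such that $X^{(i)}$ occurs in $f$, and $-\infty$ if $f$ is constant. For such a field, let $k[\delta]$ be the subring of the ring of additive endomorphisms of $k$ generated by $\delta$ and the multiplications by elements of $k$. \textbf{Theorem.} There exists a fadelian ring which is neither left nor right Noetherian. More precisely, there exists a differentially closed field $(k,\delta)$ with $\delta \neq 0$; and for every differentially closed field $(k, \delta)$ with $\delta \neq 0$ and every non-principal ultrafilter $\mathcal{U}$ on $\mathbb{N}$, the ultrapower \[ R = k[\delta]^{\mathcal{U}} = \Bigl( \prod_{n \in \mathbb{N}} k[\delta] \Bigr) / \mathcal{U} \] is a fadelian ring which is neither left nor right Noetherian. Moreover, if $e_n \in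 R$ denotes the class of the sequence \[ (\underbrace{1, 1, \dots, 1}_{n}, \delta, \delta^2, \delta^3, \dots), \] then $(R e_n)_{n \geq 0}$ is a strictly increasing sequence of left ideals of $R$, and $(e_n R)_{n \geq 0}$ is a strictly increasing sequence of right ideals of $R$. -/

import Mathlib

/-- A ring is fadelian if it is nontrivial and, for all `x` and all nonzero `a`,
there are `b` and `c` such that `x = a * b + c * a`. -/
def IsFadelian (R : Type*) [Ring R] : Prop :=
  Nontrivial R ∧ ∀ x a : R, a ≠ 0 → ∃ b c : R, x = a * b + c * a

/-- Left Noetherian: every left ideal is finitely generated. -/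
def IsLeftNoetherian (R : Type*) [Ring R] : Prop := IsNoetherian R R

/-- Right Noetherian: every right ideal is finitely generated. Right ideals are the submodules of
`R` as a module over its opposite ring, which acts on `R` by right multiplication. -/
def IsRightNoetherian (R : Type*) [Ring R] : Prop := IsNoetherian Rᵐᵒᵖ R

/-- Differential polynomials in one differential variable `X` over `k`: the polynomials in the
variables `X, X', X'', …`, where the variable of index `i` stands for the `i`-th derivative. -/
abbrev DiffPoly (k : Type*) [Field k] : Type _ := MvPolynomial ℕ k

namespace DiffPoly

variable {k : Type*} [Field k]

/-- The order of a differential polynomial: the largest `i` such that the `i`-th derivative of `X`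
occurs in it. The order of a constant is `⊥`, which is less than `0`. -/
noncomputable def order (f : DiffPoly k) : WithBot ℕ := (MvPolynomial.vars f).max

/-- The value of a differential polynomial at `x`, for the derivation `δ`. -/
noncomputable def evalAt (δ : Derivation ℤ k k) (f : DiffPoly k) (x : k) : k :=
  MvPolynomial.eval (fun i => (δ^[i]) x) f

end DiffPoly

/-- `(k, δ)` is a differentially closed field (of characteristic zero): whenever `f` and `g` are
differential polynomials, `g` is nonzero and the order of `f` is larger than that of `g`, some
element `x` of `k` satisfies `f(x) = 0` and `g(x) ≠ 0`. -/
structure IsDifferentiallyClosed {k : Type*} [Field k] (δ : Derivation ℤ k k) : Prop where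
  charZero : CharZero k
  exists_solution : ∀ f g : DiffPoly k, g ≠ 0 → g.order < f.order →
    ∃ x : k, f.evalAt δ x = 0 ∧ g.evalAt δ x ≠ 0

/-- The ring `k[δ]` of differential operators: the subring of the ring of additive endomorphisms
of `k` generated by `δ` and the multiplications by elements of `k`. -/
def diffOpRing {k : Type*} [Field k] (δ : Derivation ℤ k k) : Subalgebra ℤ (Module.End ℤ k) :=
  Algebra.adjoin ℤ
    (insert (δ : k →ₗ[ℤ] k) (Set.range fun a : k => LinearMap.mulLeft ℤ a))

/-- The derivation `δ`, as an element of `k[δ]`. -/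
def diffOpRing.delta {k : Type*} [Field k] (δ : Derivation ℤ k k) : diffOpRing δ :=
  ⟨(δ : k →ₗ[ℤ] k), Algebra.subset_adjoin (Set.mem_insert _ _)⟩

/-- The ultrapower of `R` with respect to an ultrafilter `U` on `ℕ`: sequences in `R`, two of which
are identified when they agree on a set of `U`, with the coordinatewise operations. -/
abbrev Ultrapower (R : Type*) (U : Ultrafilter ℕ) : Type _ := Filter.Germ (U : Filter ℕ) R

/-- The class, in the ultrapower of `k[δ]`, of the sequence `(1, …, 1, δ, δ², δ³, …)` that starts
with `n` terms equal to `1`. -/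
def ultraE {k : Type*} [Field k] (δ : Derivation ℤ k k) (U : Ultrafilter ℕ) (n : ℕ) :
    Ultrapower (diffOpRing δ) U :=
  Filter.Germ.ofFun fun m : ℕ =>
    if m < n then 1 else diffOpRing.delta δ ^ (m - n + 1)

/-!
There are two independent parts: the existence of a differentially closed field, and the study of
`k[δ]` over any such field.

*Existence.* Let `L` be a countable algebraically closed field of characteristic zero with a
transcendence basis `t (r, i)`, arranged in rows `r`. Since `L` is formally étale over
`ℚ[t]`, a derivation of `L` may be given arbitrary values on the basis
(`IsTranscendenceBasis.exists_derivation`). So each row can be reserved for one differential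
polynomial `f`, of order `n`: the derivation sends `t (r, i)` to `t (r, i + 1)` as long as
`i + 1 < n`, and sends `t (r, n - 1)` to a root `z` of `f (t (r, 0), …, t (r, n - 1), Z)`; then
`x = t (r, 0)`, or `x = z` if `n = 0`, is a zero of `f`. Each `f` gets infinitely many rows, and finitely many coefficients
are algebraic over the complement of all but finitely many rows
(`IsTranscendenceBasis.exists_finite_row`). In a row that is independent over the coefficients of
`f` and `g`, the root exists (`AlgebraicIndependent.exists_eval_update_eq_zero`) and `g`, which has
smaller order, does not vanish at `x`.

*Fadelian.* Let `a` be a nonzero operator. A nonzero solution `w` of `a w = 0` gives a factor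
`δ - δ w / w` of `a` on the right, so `a` is a nonzero constant times a product of operators
`δ - h`, each of which is surjective on `k` with nonzero kernel. By induction along this product,
`a` is surjective and has a set `S` of solutions on which operators can be prescribed arbitrarily
and such that the operators vanishing on `S` are the left multiples of `a`
(`diffOpRing.IsFundamental`, `diffOpRing.isFundamental_of_ne_zero`). Given `x`, choose for each
`y ∈ S` an element `z y` with `a (z y) = x y`, and an operator `b` with `b y = z y` on `S`. Then
`x - a * b` vanishes on `S`, hence equals `c * a` for some `c`. The fadelian property passes to the
ultrapower coordinate by coordinate.

*Strict chains.* The classes `e n` satisfy `e n = d * e (n + 1) = e (n + 1) * d`, where `d` has the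
coordinates `1` before `n` and `δ` afterwards. A relation `x * e n = e (n + 1)` or
`e n * x = e (n + 1)` would give, at some coordinate, `x * δ ^ (j + 1) = δ ^ j` or
`δ ^ (j + 1) * x = δ ^ j` in `k[δ]`, and neither is possible
(`diffOpRing.mul_delta_pow_succ_ne`, `diffOpRing.delta_pow_succ_mul_ne`).
-/

/-! ### Derivations with prescribed values on a transcendence basis -/

open TensorProduct in
/-- A derivation from a domain to an algebraic field extension of characteristic zero extends to the
extension, because the extension is formally étale over the domain. -/
theorem Derivation.exists_extend_of_isAlgebraic.{u} {A L : Type u} [CommRing A] [IsDomain A] [Field L]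
    [CharZero L] [Algebra A L] [FaithfulSMul A L] [Algebra.IsAlgebraic A L]
    (d : Derivation ℤ A L) : ∃ D : Derivation ℤ L L, ∀ a, D (algebraMap A L a) = d a := by
  let := FractionRing.liftAlgebra A L
  have := FractionRing.isScalarTower_liftAlgebra A L
  have : Algebra.IsAlgebraic (FractionRing A) L :=
    .extendScalars (IsFractionRing.injective A (FractionRing A))
  have : CharZero (FractionRing A) := (algebraMap (FractionRing A) L).charZero
  have : Algebra.FormallyEtale A (FractionRing A) := .of_isLocalization (nonZeroDivisors A)
  have : Algebra.FormallyEtale (FractionRing A) L := .of_isSeparable _ _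
  have : Algebra.FormallyEtale A L := .comp A (FractionRing A) L
  let φ : Ω[L⁄ℤ] →ₗ[L] L := d.liftKaehlerDifferential.liftBaseChange L ∘ₗ
    (KaehlerDifferential.tensorKaehlerEquivOfFormallyEtale ℤ A L).symm.toLinearMap
  refine ⟨φ.compDer (KaehlerDifferential.D ℤ L), fun a ↦ ?_⟩
  simp [φ, KaehlerDifferential.tensorKaehlerEquivOfFormallyEtale_symm_D_algebraMap]

theorem IsTranscendenceBasis.exists_derivation.{u} {σ L : Type u} [Field L] [Algebra ℚ L] {t : σ → L}
    (ht : IsTranscendenceBasis ℚ t) (v : σ → L) :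
    ∃ D : Derivation ℤ L L, ∀ s, D (t s) = v s := by
  have : CharZero L := algebraRat.charZero L
  let := (MvPolynomial.aeval (R := ℚ) t).toAlgebra
  have : IsScalarTower ℚ (MvPolynomial σ ℚ) L := .of_algHom (MvPolynomial.aeval (R := ℚ) t)
  have hinj : Function.Injective (algebraMap (MvPolynomial σ ℚ) L) := ht.1
  have : FaithfulSMul (MvPolynomial σ ℚ) L := (faithfulSMul_iff_algebraMap_injective _ _).2 hinj
  have : Algebra.IsAlgebraic (MvPolynomial σ ℚ) L := by
    refine ⟨fun x ↦ ?_⟩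
    have hx := ht.isAlgebraic.isAlgebraic x
    rw [Algebra.adjoin_range_eq_range_aeval] at hx
    exact hx.of_ringHom_of_comp_eq (MvPolynomial.aeval (R := ℚ) t).rangeRestrict
      (RingHom.id L) (AlgHom.rangeRestrict_surjective _) Function.injective_id rfl
  obtain ⟨D, hD⟩ := Derivation.exists_extend_of_isAlgebraic
    ((MvPolynomial.mkDerivation ℚ v).restrictScalars ℤ)
  refine ⟨D, fun s ↦ ?_⟩
  have h : D (MvPolynomial.aeval t (MvPolynomial.X (R := ℚ) s)) =
    MvPolynomial.mkDerivation ℚ v (MvPolynomial.X s) := hD (MvPolynomial.X s)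
  rwa [MvPolynomial.aeval_X, MvPolynomial.mkDerivation_X] at h

/-! ### A countable algebraically closed field of infinite transcendence degree -/

instance MvPolynomial.instCountable {σ R : Type*} [CommSemiring R] [Countable R] [Countable σ] :
    Countable (MvPolynomial σ R) := by
  classical
  rw [← Cardinal.mk_le_aleph0_iff]
  refine MvPolynomial.cardinalMk_le_max_lift.trans ?_
  simp

theorem exists_isTranscendenceBasis_countable (σ : Type) [Countable σ] :
    ∃ (L : Type) (_ : Field L) (_ : Algebra ℚ L) (t : σ → L),
      IsAlgClosed L ∧ Countable L ∧ IsTranscendenceBasis ℚ t := by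
  let K := FractionRing (MvPolynomial σ ℚ)
  let L := AlgebraicClosure K
  have : Countable K := by
    let f := fun x : MvPolynomial σ ℚ × nonZeroDivisors (MvPolynomial σ ℚ) ↦
      IsLocalization.mk' K x.1 x.2
    refine Function.Surjective.countable (f := f) fun x ↦ ?_
    obtain ⟨a, b, h⟩ := IsLocalization.exists_mk'_eq (nonZeroDivisors (MvPolynomial σ ℚ)) x
    exact ⟨(a, b), h⟩
  have hL : Countable L := by
    have := Algebraic.countable K L
    simpa [Set.countable_univ_iff, Algebra.IsAlgebraic.isAlgebraic] using this
  refine ⟨L, inferInstance, inferInstance, fun i ↦ algebraMap _ _ (MvPolynomial.X (R := ℚ) i),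
    inferInstance, hL, ?_⟩
  have : Algebra.IsAlgebraic (MvPolynomial σ ℚ) L :=
    (IsFractionRing.comap_isAlgebraic_iff (K := K)).2 inferInstance
  have hX : IsTranscendenceBasis ℚ (MvPolynomial.X : σ → MvPolynomial σ ℚ) := by
    refine (MvPolynomial.algebraicIndependent_X σ ℚ).isTranscendenceBasis_iff_isAlgebraic.2 ?_
    rw [MvPolynomial.adjoin_range_X]
    exact ⟨fun x ↦ isAlgebraic_algebraMap (⟨x, trivial⟩ : (⊤ : Subalgebra ℚ (MvPolynomial σ ℚ)))⟩
  have : FaithfulSMul (MvPolynomial σ ℚ) L := (faithfulSMul_iff_algebraMap_injective _ _).2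
    ((algebraMap K L).injective.comp (IsFractionRing.injective (MvPolynomial σ ℚ) K))
  exact hX.algebraMap_comp

/-- Finitely many elements are algebraic over the elements of a transcendence basis outside all but
finitely many of its rows, so each of the other rows is independent over them. -/
theorem IsTranscendenceBasis.exists_finite_row {ρ L : Type} [Field L] [Algebra ℚ L]
    {t : ρ × ℕ → L} (ht : IsTranscendenceBasis ℚ t) {s : Set L} (hs : s.Finite) :
    ∃ J : Set ρ, J.Finite ∧ ∀ r ∉ J, ∃ A : Subring L, s ⊆ A ∧
      AlgebraicIndependent A fun i ↦ t (r, i) := by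
  have key : ∀ x : L, ∃ I ⊆ Set.range t, I.Finite ∧
      x ∈ (AlgebraicIndependent.matroid ℚ L).closure I := fun x ↦ by
    have hx : x ∈ (AlgebraicIndependent.matroid ℚ L).closure (Set.range t) := by
      rw [AlgebraicIndependent.matroid_closure_eq]
      exact ht.isAlgebraic.isAlgebraic x
    obtain ⟨I, h1, h2, -, h3⟩ := Matroid.exists_mem_finite_closure_of_mem_closure hx
    exact ⟨I, h1, h2, h3⟩
  choose I hI hfin hmem using key
  refine ⟨Prod.fst '' (t ⁻¹' ⋃ x ∈ s, I x), ((hs.biUnion fun x _ ↦ hfin x).preimage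
    ht.1.injective.injOn).image _, fun r hr ↦ ?_⟩
  have hdisj : Disjoint {p : ρ × ℕ | p.1 ≠ r} {p : ρ × ℕ | p.1 = r} :=
    Set.disjoint_left.2 fun p hp hp' ↦ hp hp'
  refine ⟨(Subalgebra.algebraicClosure (Algebra.adjoin ℚ (t '' {p | p.1 ≠ r})) L).toSubring,
    fun x hx ↦ ?_, ?_⟩
  · have : x ∈ (AlgebraicIndependent.matroid ℚ L).closure (t '' {p | p.1 ≠ r}) := by
      refine (AlgebraicIndependent.matroid ℚ L).closure_subset_closure ?_ (hmem x)
      intro y hy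
      obtain ⟨p, rfl⟩ := hI x hy
      refine ⟨p, fun h ↦ hr ⟨p, ?_, h⟩, rfl⟩
      exact Set.mem_biUnion hx hy
    rw [AlgebraicIndependent.matroid_closure_eq] at this
    exact this
  · exact ((ht.1.adjoin_of_disjoint hdisj).subalgebraAlgebraicClosure).comp
      (fun i : ℕ ↦ (⟨(r, i), rfl⟩ : {p : ρ × ℕ | p.1 = r})) fun i j h ↦ by simpa using h

/-! ### Existence of differentially closed fields -/

/-- At algebraically independent arguments, a polynomial has a zero in each variable that occurs in
it: otherwise its value would not depend on that variable, which could then be replaced by another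
one without changing the polynomial. -/
theorem AlgebraicIndependent.exists_eval_update_eq_zero {L : Type*} [Field L] [IsAlgClosed L]
    {A : Subring L} {y : ℕ → L} (hy : AlgebraicIndependent A y) {f : MvPolynomial ℕ L}
    (hf : (f.coeffs : Set L) ⊆ A) {n : ℕ} (hn : n ∈ f.vars) :
    ∃ z, MvPolynomial.eval (Function.update y n z) f = 0 := by
  let F : Polynomial L := MvPolynomial.aeval
    (Function.update (fun i ↦ Polynomial.C (y i)) n Polynomial.X) f
  have hF : ∀ z, F.eval z = MvPolynomial.eval (Function.update y n z) f := fun z ↦ by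
    have : (Polynomial.aeval z).comp (MvPolynomial.aeval
        (Function.update (fun i ↦ Polynomial.C (y i)) n Polynomial.X)) =
        MvPolynomial.aeval (R := L) (Function.update y n z) := by
      ext i
      by_cases h : i = n
      · subst h; simp
      · simp [h]
    simpa [F, Polynomial.aeval_def, MvPolynomial.aeval_eq_eval] using DFunLike.congr_fun this f
  by_contra! hne
  have hdeg : F.degree = 0 := by
    by_contra h
    obtain ⟨z, hz⟩ := IsAlgClosed.exists_root F h
    exact hne z ((hF z).symm.trans hz)
  have hconst : F.eval (y n) = F.eval (y (n + 1)) := by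
    rw [Polynomial.eq_C_of_degree_eq_zero hdeg]; simp
  obtain ⟨f₀, rfl⟩ := MvPolynomial.mem_range_map_iff_coeffs_subset.2
    (show (f.coeffs : Set L) ⊆ Set.range A.subtype by simpa using hf)
  let e : ℕ → ℕ := Function.update id n (n + 1)
  have hfe : f₀ = MvPolynomial.rename e f₀ := by
    refine hy ?_
    rw [hF, hF, Function.update_eq_self] at hconst
    rw [MvPolynomial.aeval_rename]
    have he : y ∘ e = Function.update y n (y (n + 1)) := by
      ext i
      by_cases h : i = n
      · subst h; simp [e]
      · simp [e, h]
    rw [he]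
    rwa [MvPolynomial.eval_map, MvPolynomial.eval_map] at hconst
  rw [MvPolynomial.vars_map_of_injective _ A.subtype_injective, hfe] at hn
  obtain ⟨i, -, hi⟩ := Finset.mem_image.1 (MvPolynomial.vars_rename e f₀ hn)
  by_cases h : i = n
  · subst h; simp [e] at hi
  · simp [e, h] at hi

theorem AlgebraicIndependent.eval_ne_zero {L : Type*} [Field L]
    {A : Subring L} {y : ℕ → L} (hy : AlgebraicIndependent A y) {g : MvPolynomial ℕ L}
    (hg : (g.coeffs : Set L) ⊆ A) (h0 : g ≠ 0) : MvPolynomial.eval y g ≠ 0 := by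
  obtain ⟨g₀, rfl⟩ := MvPolynomial.mem_range_map_iff_coeffs_subset.2
    (show (g.coeffs : Set L) ⊆ Set.range A.subtype by simpa using hg)
  intro h
  refine h0 ?_
  rw [hy (a₁ := g₀) (a₂ := 0) (by rwa [MvPolynomial.eval_map] at h),
    map_zero]

theorem MvPolynomial.eval_congr_of_vars {σ R : Type*} [CommSemiring R] {p : MvPolynomial σ R}
    {x y : σ → R} (h : ∀ i ∈ p.vars, x i = y i) : eval x p = eval y p :=
  eval₂Hom_congr' rfl (fun i hi _ ↦ h i hi) rfl

theorem exists_isDifferentiallyClosed :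
    ∃ (k : Type) (_ : Field k) (δ : Derivation ℤ k k), IsDifferentiallyClosed δ := by
  obtain ⟨L, _, _, t, _, _, ht⟩ := exists_isTranscendenceBasis_countable ((ℕ × ℕ) × ℕ)
  obtain ⟨e, he⟩ := exists_surjective_nat (DiffPoly L)
  -- constant polynomials never occur as `f`, so the value `0` for them is immaterial
  let n : ℕ → ℕ := fun s ↦ (e s).order.unbotD 0
  -- the value prescribed for the `n`-th derivative of the solution attached to a row
  have hroot : ∀ r : ℕ × ℕ, ∃ z : L,
      (∃ z', MvPolynomial.eval (Function.update (fun i ↦ t (r, i)) (n r.1) z') (e r.1) = 0) →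
      MvPolynomial.eval (Function.update (fun i ↦ t (r, i)) (n r.1) z) (e r.1) = 0 := fun r ↦ by
    by_cases h : ∃ z', MvPolynomial.eval
      (Function.update (fun i ↦ t (r, i)) (n r.1) z') (e r.1) = 0
    · exact ⟨h.choose, fun _ ↦ h.choose_spec⟩
    · exact ⟨0, fun h' ↦ absurd h' h⟩
  choose z hz using hroot
  obtain ⟨δ, hδ⟩ := ht.exists_derivation fun p ↦
    if p.2 + 1 < n p.1.1 then t (p.1, p.2 + 1) else z p.1
  refine ⟨L, inferInstance, δ, algebraRat.charZero L, fun f g hg hgf ↦ ?_⟩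
  obtain ⟨s, rfl⟩ := he f
  -- a copy of the row `s` that is independent over the coefficients of both polynomials
  obtain ⟨J, hJ, hrow⟩ := ht.exists_finite_row
    ((e s).coeffs.finite_toSet.union g.coeffs.finite_toSet)
  obtain ⟨m, hm⟩ := (hJ.preimage (f := fun m : ℕ ↦ (s, m))
    (fun a _ b _ h ↦ by simpa using h)).exists_notMem
  obtain ⟨A, hA, hy⟩ := hrow (s, m) hm
  have hord : (e s).order = WithBot.some (n s) := by
    have : (e s).order ≠ ⊥ := ne_bot_of_gt hgf
    obtain ⟨a, ha⟩ := WithBot.ne_bot_iff_exists.1 this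
    simp [n, ← ha]
  have hmem : n s ∈ (e s).vars := Finset.mem_of_max hord
  have hroot := hz (s, m) (hy.exists_eval_update_eq_zero (Set.subset_union_left.trans hA) hmem)
  have hlt : ∀ i ∈ g.vars, i < n s := fun i hi ↦ by
    have := (Finset.le_max hi).trans_lt (hgf.trans_eq hord)
    exact WithBot.coe_lt_coe.1 this
  have hle : ∀ i ∈ (e s).vars, i ≤ n s := fun i hi ↦ by
    have := (Finset.le_max hi).trans_eq hord
    exact WithBot.coe_le_coe.1 this
  obtain ⟨x, hx⟩ : ∃ x : L, ∀ i ≤ n s,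
      δ^[i] x = Function.update (fun i ↦ t ((s, m), i)) (n s) (z (s, m)) i := by
    rcases Nat.eq_zero_or_pos (n s) with h | h
    · refine ⟨z (s, m), fun i hi ↦ ?_⟩
      obtain rfl : i = 0 := by omega
      simp [h]
    · refine ⟨t ((s, m), 0), fun i ↦ ?_⟩
      induction i with
      | zero => intro _; simp [h.ne]
      | succ i ih =>
        intro hi
        rw [Function.iterate_succ_apply', ih (by omega), Function.update_of_ne (by omega), hδ]
        by_cases h' : i + 1 < n s
        · rw [if_pos h', Function.update_of_ne (by omega)]
        · obtain h2 : i + 1 = n s := by omega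
          simp [h2]
  refine ⟨x, ?_, ?_⟩
  · rw [DiffPoly.evalAt, MvPolynomial.eval_congr_of_vars fun i hi ↦ hx i (hle i hi)]
    exact hroot
  · rw [DiffPoly.evalAt, MvPolynomial.eval_congr_of_vars (y := fun i ↦ t ((s, m), i))]
    · exact hy.eval_ne_zero (Set.subset_union_right.trans hA) hg
    · intro i hi
      rw [hx i (hlt i hi).le, Function.update_of_ne (hlt i hi).ne]

namespace diffOpRing

variable {k : Type*} [Field k] {δ : Derivation ℤ k k}

/-! ### Differential operators of bounded order -/

/-- The space of the operators `∑ i < m, c i • δ ^ i`, for the action of `k` on endomorphisms by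
left multiplication. -/
def orderLT (δ : Derivation ℤ k k) (m : ℕ) : Submodule k (Module.End ℤ k) :=
  Submodule.span k ((fun i : ℕ ↦ ((δ : k →ₗ[ℤ] k) : Module.End ℤ k) ^ i) '' Set.Iio m)

theorem orderLT_mono : Monotone (orderLT δ) := fun _ _ h ↦
  Submodule.span_mono (Set.image_mono (Set.Iio_subset_Iio h))

theorem pow_mem_orderLT {i m : ℕ} (h : i < m) :
    ((δ : k →ₗ[ℤ] k) : Module.End ℤ k) ^ i ∈ orderLT δ m :=
  Submodule.subset_span ⟨i, h, rfl⟩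

theorem eq_zero_of_mem_orderLT_zero {v : Module.End ℤ k} (hv : v ∈ orderLT δ 0) : v = 0 := by
  simpa [orderLT] using hv

theorem exists_of_mem_orderLT_succ {m : ℕ} {v : Module.End ℤ k} (hv : v ∈ orderLT δ (m + 1)) :
    ∃ c : k, ∃ w ∈ orderLT δ m, v = c • ((δ : k →ₗ[ℤ] k) : Module.End ℤ k) ^ m + w := by
  have : Set.Iio (m + 1) = insert m (Set.Iio m) := by ext i; simp
  rw [orderLT, this, Set.image_insert_eq] at hv
  exact Submodule.mem_span_insert.1 hv

theorem delta_mul_mem_orderLT {m : ℕ} {v : Module.End ℤ k} (hv : v ∈ orderLT δ m) :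
    ((δ : k →ₗ[ℤ] k) : Module.End ℤ k) * v ∈ orderLT δ (m + 1) := by
  induction hv using Submodule.span_induction with
  | mem x hx =>
    obtain ⟨i, hi, rfl⟩ := hx
    dsimp only
    rw [← pow_succ']
    exact pow_mem_orderLT (Nat.succ_lt_succ hi)
  | zero => simp
  | add x y _ _ hx hy => rw [mul_add]; exact add_mem hx hy
  | smul c x hx ih =>
    have : ((δ : k →ₗ[ℤ] k) : Module.End ℤ k) * (c • x) =
        c • (((δ : k →ₗ[ℤ] k) : Module.End ℤ k) * x) + δ c • x := by
      ext y
      simp [Derivation.leibniz, mul_comm]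
    rw [this]
    exact add_mem (Submodule.smul_mem _ _ ih)
      (Submodule.smul_mem _ _ (orderLT_mono (Nat.le_succ m) hx))

theorem mulLeft_mem (c : k) : LinearMap.mulLeft ℤ c ∈ diffOpRing δ :=
  Algebra.subset_adjoin (Set.mem_insert_of_mem _ ⟨c, rfl⟩)

theorem delta_mem : ((δ : k →ₗ[ℤ] k) : Module.End ℤ k) ∈ diffOpRing δ :=
  (delta δ).2

theorem smul_eq_mulLeft_mul (c : k) (v : Module.End ℤ k) :
    c • v = LinearMap.mulLeft ℤ c * v := rfl

theorem mem_of_mem_orderLT {m : ℕ} {v : Module.End ℤ k} (hv : v ∈ orderLT δ m) :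
    v ∈ diffOpRing δ := by
  induction hv using Submodule.span_induction with
  | mem x hx =>
    obtain ⟨i, hi, rfl⟩ := hx
    exact pow_mem delta_mem i
  | zero => exact zero_mem _
  | add x y _ _ hx hy => exact add_mem hx hy
  | smul c x hx ih => exact mul_mem (mulLeft_mem c) ih

/-- Every element of `k[δ]` is a sum `∑ i < m, c i • δ ^ i`: these sums are stable under left
multiplication by the generators of `k[δ]`. -/
theorem exists_mem_orderLT {P : Module.End ℤ k} (hP : P ∈ diffOpRing δ) :
    ∃ m, P ∈ orderLT δ m := by
  suffices h : ∀ m, ∀ v ∈ orderLT δ m, ∃ m', P * v ∈ orderLT δ m' by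
    obtain ⟨m, hm⟩ := h 1 1 (by simpa using pow_mem_orderLT (δ := δ) (Nat.zero_lt_one))
    exact ⟨m, by simpa using hm⟩
  induction hP using Algebra.adjoin_induction with
  | mem x hx =>
    intro m v hv
    rcases hx with rfl | ⟨c, rfl⟩
    · exact ⟨m + 1, delta_mul_mem_orderLT hv⟩
    · exact ⟨m, Submodule.smul_mem _ c hv⟩
  | algebraMap r =>
    intro m v hv
    exact ⟨m, by rw [← Algebra.smul_def]; exact zsmul_mem hv r⟩
  | add x y _ _ hx hy =>
    intro m v hv
    obtain ⟨a, ha⟩ := hx m v hv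
    obtain ⟨b, hb⟩ := hy m v hv
    refine ⟨max a b, ?_⟩
    rw [add_mul]
    exact add_mem (orderLT_mono (le_max_left a b) ha) (orderLT_mono (le_max_right a b) hb)
  | mul x y _ _ hx hy =>
    intro m v hv
    obtain ⟨a, ha⟩ := hy m v hv
    obtain ⟨b, hb⟩ := hx a _ ha
    exact ⟨b, by rwa [mul_assoc]⟩

theorem exists_leading_term {m : ℕ} {P : Module.End ℤ k} (hP : P ∈ orderLT δ m) (h0 : P ≠ 0) :
    ∃ n : ℕ, ∃ c : k, c ≠ 0 ∧ ∃ v ∈ orderLT δ n,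
      P = c • ((δ : k →ₗ[ℤ] k) : Module.End ℤ k) ^ n + v := by
  induction m with
  | zero => exact absurd (eq_zero_of_mem_orderLT_zero hP) h0
  | succ m ih =>
    obtain ⟨c, v, hv, rfl⟩ := exists_of_mem_orderLT_succ hP
    by_cases hc : c = 0
    · exact ih (by simpa [hc] using hv)
    · exact ⟨m, c, hc, v, hv, rfl⟩

theorem pow_mul_mulLeft_mem_orderLT (m : ℕ) (h : k) :
    ((δ : k →ₗ[ℤ] k) : Module.End ℤ k) ^ m * LinearMap.mulLeft ℤ h ∈ orderLT δ (m + 1) := by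
  induction m with
  | zero =>
    have := (orderLT δ 1).smul_mem h (pow_mem_orderLT Nat.zero_lt_one)
    simpa [smul_eq_mulLeft_mul] using this
  | succ m ih => rw [pow_succ', mul_assoc]; exact delta_mul_mem_orderLT ih

/-- Division with remainder on the right by the operator `δ - h` of order one. -/
theorem exists_eq_mul_delta_sub_add (h : k) {m : ℕ} {v : Module.End ℤ k}
    (hv : v ∈ orderLT δ (m + 1)) : ∃ q ∈ orderLT δ m, ∃ r : k,
      v = q * (((δ : k →ₗ[ℤ] k) : Module.End ℤ k) - LinearMap.mulLeft ℤ h) +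
        LinearMap.mulLeft ℤ r := by
  induction m generalizing v with
  | zero =>
    obtain ⟨c, w, hw, rfl⟩ := exists_of_mem_orderLT_succ hv
    refine ⟨0, zero_mem _, c, ?_⟩
    simp [eq_zero_of_mem_orderLT_zero hw, smul_eq_mulLeft_mul]
  | succ m ih =>
    obtain ⟨c, w, hw, rfl⟩ := exists_of_mem_orderLT_succ hv
    obtain ⟨q, hq, r, hr⟩ := ih (add_mem ((orderLT δ (m + 1)).smul_mem c
      (pow_mul_mulLeft_mem_orderLT m h)) hw)
    refine ⟨c • ((δ : k →ₗ[ℤ] k) : Module.End ℤ k) ^ m + q, add_mem (Submodule.smul_mem _ _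
      (pow_mem_orderLT m.lt_succ_self)) (orderLT_mono m.le_succ hq), r, ?_⟩
    rw [add_mul, add_assoc, ← hr, smul_mul_assoc, mul_sub, ← pow_succ, smul_sub]
    abel

/-! ### Linear differential equations over a differentially closed field -/

theorem exists_diffPoly_of_mem_orderLT {m : ℕ} {v : Module.End ℤ k} (hv : v ∈ orderLT δ m) :
    ∃ f : DiffPoly k, (∀ i ∈ f.vars, i < m) ∧ ∀ x, f.evalAt δ x = v x := by
  classical
  induction hv using Submodule.span_induction with
  | mem x hx =>
    obtain ⟨i, hi, rfl⟩ := hx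
    refine ⟨MvPolynomial.X i, by simpa [MvPolynomial.vars_X] using hi, fun x ↦ ?_⟩
    simp [DiffPoly.evalAt, Module.End.pow_apply]
  | zero => exact ⟨0, by simp, by simp [DiffPoly.evalAt]⟩
  | add x y _ _ hx hy =>
    obtain ⟨f, hf, hfx⟩ := hx
    obtain ⟨g, hg, hgx⟩ := hy
    refine ⟨f + g, fun i hi ↦ ?_, fun z ↦ ?_⟩
    · rcases Finset.mem_union.1 (MvPolynomial.vars_add_subset f g hi) with h | h
      exacts [hf i h, hg i h]
    · simpa [DiffPoly.evalAt] using congr_arg₂ (· + ·) (hfx z) (hgx z)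
  | smul c x hx ih =>
    obtain ⟨f, hf, hfx⟩ := ih
    refine ⟨MvPolynomial.C c * f, fun i hi ↦ hf i ?_, fun z ↦ ?_⟩
    · simpa using MvPolynomial.vars_mul _ _ hi
    · simpa [DiffPoly.evalAt] using congr_arg (c * ·) (hfx z)

end diffOpRing

/-- An inhomogeneous linear equation with leading term `c • δ ^ m`, `c ≠ 0`, has a solution that is
not a zero of a given nonzero differential polynomial of order less than `m`. -/
theorem IsDifferentiallyClosed.exists_linear {k : Type*} [Field k] {δ : Derivation ℤ k k}
    (hδ : IsDifferentiallyClosed δ) {m : ℕ} {c : k} (hc : c ≠ 0) {v : Module.End ℤ k}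
    (hv : v ∈ diffOpRing.orderLT δ m) (z : k) {g : DiffPoly k} (hg : g ≠ 0)
    (hgm : ∀ i ∈ g.vars, i < m) :
    ∃ x, (c • ((δ : k →ₗ[ℤ] k) : Module.End ℤ k) ^ m + v) x = z ∧ g.evalAt δ x ≠ 0 := by
  classical
  obtain ⟨p, hp, hpx⟩ := diffOpRing.exists_diffPoly_of_mem_orderLT hv
  let f : DiffPoly k := MvPolynomial.C c * MvPolynomial.X m + p - MvPolynomial.C z
  have hpm : MvPolynomial.coeff (Finsupp.single m 1) p = 0 := by
    by_contra h
    exact (hp m ((MvPolynomial.mem_vars_iff_mem_support m).2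
      ⟨_, MvPolynomial.mem_support_iff.2 h, by simp⟩)).false
  have hfm : m ∈ f.vars := by
    refine (MvPolynomial.mem_vars_iff_mem_support m).2 ⟨Finsupp.single m 1, ?_, by simp⟩
    have : (0 : ℕ →₀ ℕ) ≠ Finsupp.single m 1 := fun h ↦ by
      simpa using DFunLike.congr_fun h m
    rw [MvPolynomial.mem_support_iff]
    simp [f, hpm, MvPolynomial.coeff_C, this, hc]
  have hlt : g.order < f.order := by
    refine lt_of_lt_of_le ?_ (Finset.le_max hfm)
    refine (Finset.sup_lt_iff (WithBot.bot_lt_coe m)).2 fun i hi ↦ ?_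
    exact WithBot.coe_lt_coe.2 (hgm i hi)
  obtain ⟨x, hx, hgx⟩ := hδ.exists_solution f g hg hlt
  refine ⟨x, ?_, hgx⟩
  rw [← sub_eq_zero, ← hx]
  simp [DiffPoly.evalAt, f, ← hpx, Module.End.pow_apply]

theorem IsDifferentiallyClosed.exists_ker {k : Type*} [Field k] {δ : Derivation ℤ k k}
    (hδ : IsDifferentiallyClosed δ) {m : ℕ} {c : k} (hc : c ≠ 0) {v : Module.End ℤ k}
    (hv : v ∈ diffOpRing.orderLT δ (m + 1)) :
    ∃ w, (c • ((δ : k →ₗ[ℤ] k) : Module.End ℤ k) ^ (m + 1) + v) w = 0 ∧ w ≠ 0 := by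
  obtain ⟨w, hw, hw0⟩ := hδ.exists_linear hc hv 0 (g := MvPolynomial.X 0)
    (MvPolynomial.X_ne_zero 0) (by simp [MvPolynomial.vars_X])
  exact ⟨w, hw, by simpa [DiffPoly.evalAt] using hw0⟩

theorem IsDifferentiallyClosed.surjective_delta_sub {k : Type*} [Field k] {δ : Derivation ℤ k k}
    (hδ : IsDifferentiallyClosed δ) (h : k) :
    Function.Surjective
      ⇑(((δ : k →ₗ[ℤ] k) : Module.End ℤ k) - LinearMap.mulLeft ℤ h) := fun z ↦ by
  obtain ⟨x, hx, -⟩ := hδ.exists_linear (m := 1) one_ne_zero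
    ((diffOpRing.orderLT δ 1).smul_mem (-h) (diffOpRing.pow_mem_orderLT Nat.zero_lt_one)) z
    (g := 1) one_ne_zero (by simp)
  exact ⟨x, by simpa [sub_eq_add_neg] using hx⟩

theorem IsDifferentiallyClosed.exists_delta_pow {k : Type*} [Field k] {δ : Derivation ℤ k k}
    (hδ : IsDifferentiallyClosed δ) (j : ℕ) :
    ∃ y, (((δ : k →ₗ[ℤ] k) : Module.End ℤ k) ^ (j + 1)) y = 0 ∧
      (((δ : k →ₗ[ℤ] k) : Module.End ℤ k) ^ j) y ≠ 0 := by
  obtain ⟨y, hy, hyj⟩ := hδ.exists_linear (m := j + 1) one_ne_zero (zero_mem _) 0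
    (g := MvPolynomial.X j) (MvPolynomial.X_ne_zero j) (by simp [MvPolynomial.vars_X])
  exact ⟨y, by simpa using hy, by simpa [DiffPoly.evalAt, Module.End.pow_apply] using hyj⟩

namespace diffOpRing

variable {k : Type*} [Field k] {δ : Derivation ℤ k k}

/-! ### Operators with a fundamental system of solutions -/

/-- An additive endomorphism `L` of `k` is fundamental if it is surjective and some set `S` of
solutions of `L y = 0` has the two properties of a basis of the space of solutions: an operator can
be prescribed arbitrarily on `S`, and the operators that vanish on `S` are left multiples of `L`. -/
def IsFundamental (δ : Derivation ℤ k k) (L : Module.End ℤ k) : Prop :=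
  Function.Surjective L ∧ ∃ S : Set k, (∀ y ∈ S, L y = 0) ∧
    (∀ z : k → k, ∃ b ∈ diffOpRing δ, ∀ y ∈ S, b y = z y) ∧
    ∀ P ∈ diffOpRing δ, (∀ y ∈ S, P y = 0) → ∃ Q ∈ diffOpRing δ, P = Q * L

theorem IsFundamental.one : IsFundamental δ 1 :=
  ⟨Function.surjective_id, ∅, by simp, fun _ ↦ ⟨0, zero_mem _, by simp⟩,
    fun P hP _ ↦ ⟨P, hP, (mul_one P).symm⟩⟩

theorem IsFundamental.mulLeft_mul {L : Module.End ℤ k} (hL : IsFundamental δ L) {c : k}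
    (hc : c ≠ 0) : IsFundamental δ (LinearMap.mulLeft ℤ c * L) := by
  obtain ⟨hsurj, S, hS, hint, hdiv⟩ := hL
  refine ⟨fun z ↦ ?_, S, fun y hy ↦ by simp [hS y hy], hint, fun P hP h ↦ ?_⟩
  · obtain ⟨y, hy⟩ := hsurj (c⁻¹ * z)
    exact ⟨y, by simp [hy, hc]⟩
  · obtain ⟨Q, hQ, rfl⟩ := hdiv P hP h
    refine ⟨Q * LinearMap.mulLeft ℤ c⁻¹, mul_mem hQ (mulLeft_mem _), ?_⟩
    ext y
    simp [hc]

/-- The fundamental system grows by a solution `y'` of `L y' = w`, where `w` is a nonzero solution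
of the equation of order one. -/
theorem IsFundamental.delta_sub_mul (hδ : IsDifferentiallyClosed δ) {L : Module.End ℤ k}
    (hLmem : L ∈ diffOpRing δ) (hL : IsFundamental δ L) (h : k) :
    IsFundamental δ ((((δ : k →ₗ[ℤ] k) : Module.End ℤ k) - LinearMap.mulLeft ℤ h) * L) := by
  obtain ⟨hsurj, S, hS, hint, hdiv⟩ := hL
  obtain ⟨w, hw, hw0⟩ : ∃ w,
      (((δ : k →ₗ[ℤ] k) : Module.End ℤ k) - LinearMap.mulLeft ℤ h) w = 0 ∧ w ≠ 0 := by
    obtain ⟨w, hw, hw0⟩ := hδ.exists_ker (m := 0) one_ne_zero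
      ((orderLT δ 1).smul_mem (-h) (pow_mem_orderLT Nat.zero_lt_one))
    exact ⟨w, by simpa [sub_eq_add_neg] using hw, hw0⟩
  obtain ⟨y', rfl⟩ := hsurj w
  refine ⟨(hδ.surjective_delta_sub h).comp hsurj, insert y' S, ?_, fun z ↦ ?_, fun P hP hPS ↦ ?_⟩
  · rintro y (rfl | hy)
    · exact hw
    · rw [Module.End.mul_apply, hS y hy, map_zero]
  · obtain ⟨b, hb, hbz⟩ := hint z
    refine ⟨b + LinearMap.mulLeft ℤ ((z y' - b y') / L y') * L,
      add_mem hb (mul_mem (mulLeft_mem _) hLmem), ?_⟩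
    rintro y (rfl | hy)
    · simp [hw0]
    · simp [hS y hy, hbz y hy]
  · obtain ⟨Q, hQ, rfl⟩ := hdiv P hP fun y hy ↦ hPS y (Set.mem_insert_of_mem _ hy)
    have hQw : Q (L y') = 0 := hPS y' (Set.mem_insert _ _)
    obtain ⟨m, hm⟩ := exists_mem_orderLT hQ
    obtain ⟨q, hq, r, rfl⟩ := exists_eq_mul_delta_sub_add h (orderLT_mono m.le_succ hm)
    rw [LinearMap.add_apply, Module.End.mul_apply, hw, map_zero, zero_add,
      LinearMap.mulLeft_apply] at hQw
    obtain rfl : r = 0 := (mul_eq_zero.1 hQw).resolve_right hw0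
    refine ⟨q, mem_of_mem_orderLT hq, ?_⟩
    rw [LinearMap.mulLeft_zero_eq_zero, add_zero, mul_assoc]

/-- By induction on the order of the left factor, which has a nonzero solution `w` if its order is
positive and is then divisible on the right by `δ - δ w / w`. -/
theorem IsFundamental.leading_term_mul (hδ : IsDifferentiallyClosed δ) {m : ℕ} {c : k}
    (hc : c ≠ 0) {v : Module.End ℤ k} (hv : v ∈ orderLT δ m) {L : Module.End ℤ k}
    (hLmem : L ∈ diffOpRing δ) (hL : IsFundamental δ L) :
    IsFundamental δ ((c • ((δ : k →ₗ[ℤ] k) : Module.End ℤ k) ^ m + v) * L) := by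
  induction m generalizing v L with
  | zero =>
    rw [eq_zero_of_mem_orderLT_zero hv, pow_zero, add_zero, smul_eq_mulLeft_mul, mul_one]
    exact hL.mulLeft_mul hc
  | succ m ih =>
    obtain ⟨w, hw, hw0⟩ := hδ.exists_ker hc hv
    set h := δ w / w
    have hhw : (((δ : k →ₗ[ℤ] k) : Module.End ℤ k) - LinearMap.mulLeft ℤ h) w = 0 := by
      simp [h, hw0]
    obtain ⟨q, hq, r, hr⟩ := exists_eq_mul_delta_sub_add h (add_mem
      ((orderLT δ (m + 1)).smul_mem c (pow_mul_mulLeft_mem_orderLT m h)) hv)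
    have hu : c • ((δ : k →ₗ[ℤ] k) : Module.End ℤ k) ^ (m + 1) + v =
        (c • ((δ : k →ₗ[ℤ] k) : Module.End ℤ k) ^ m + q) *
          (((δ : k →ₗ[ℤ] k) : Module.End ℤ k) - LinearMap.mulLeft ℤ h) +
        LinearMap.mulLeft ℤ r := by
      rw [add_mul, add_assoc, ← hr, smul_mul_assoc, mul_sub, ← pow_succ, smul_sub]
      abel
    rw [hu, LinearMap.add_apply, Module.End.mul_apply, hhw, map_zero, zero_add,
      LinearMap.mulLeft_apply] at hw
    obtain rfl : r = 0 := (mul_eq_zero.1 hw).resolve_right hw0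
    rw [hu, LinearMap.mulLeft_zero_eq_zero, add_zero, mul_assoc]
    exact ih hq (mul_mem (sub_mem delta_mem (mulLeft_mem h)) hLmem) (hL.delta_sub_mul hδ hLmem h)

theorem isFundamental_of_ne_zero (hδ : IsDifferentiallyClosed δ) {a : Module.End ℤ k}
    (ha : a ∈ diffOpRing δ) (h0 : a ≠ 0) : IsFundamental δ a := by
  obtain ⟨m, hm⟩ := exists_mem_orderLT ha
  obtain ⟨n, c, hc, v, hv, rfl⟩ := exists_leading_term hm h0
  simpa using IsFundamental.one.leading_term_mul hδ hc hv (one_mem _)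

/-! ### The ring of differential operators -/

theorem isFadelian (hδ : IsDifferentiallyClosed δ) : IsFadelian (diffOpRing δ) := by
  refine ⟨inferInstance, fun x a ha ↦ ?_⟩
  obtain ⟨hsurj, S, hS, hint, hdiv⟩ := isFundamental_of_ne_zero hδ a.2
    (fun h ↦ ha (Subtype.ext h))
  -- `b` is chosen so that `x - a * b` vanishes on the fundamental system of `a`
  choose z hz using fun y ↦ hsurj (x.1 y)
  obtain ⟨b, hb, hbz⟩ := hint z
  obtain ⟨c, hc, hcx⟩ := hdiv (x.1 - a.1 * b) (sub_mem x.2 (mul_mem a.2 hb)) fun y hy ↦ by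
    rw [LinearMap.sub_apply, Module.End.mul_apply, hbz y hy, hz, sub_self]
  exact ⟨⟨b, hb⟩, ⟨c, hc⟩, Subtype.ext (sub_eq_iff_eq_add'.1 hcx)⟩

theorem mul_delta_pow_succ_ne (hδ : IsDifferentiallyClosed δ) (x : diffOpRing δ) (j : ℕ) :
    x * delta δ ^ (j + 1) ≠ delta δ ^ j := fun h ↦ by
  obtain ⟨y, hy, hy0⟩ := hδ.exists_delta_pow j
  refine hy0 ?_
  have h' : x.1 ((((δ : k →ₗ[ℤ] k) : Module.End ℤ k) ^ (j + 1)) y) =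
    (((δ : k →ₗ[ℤ] k) : Module.End ℤ k) ^ j) y := congr_arg (fun P : diffOpRing δ ↦ P.1 y) h
  rw [← h', hy, map_zero]

theorem delta_pow_succ_mul_ne (hδ : IsDifferentiallyClosed δ) (x : diffOpRing δ) (j : ℕ) :
    delta δ ^ (j + 1) * x ≠ delta δ ^ j := fun h ↦ by
  -- nonzero operators are surjective, so `δ ^ j` can be cancelled on the left
  have hx : delta δ * x = 1 := by
    by_contra hne
    obtain ⟨hsurj, -⟩ := isFundamental_of_ne_zero hδ (delta δ * x - 1).2
      fun h0 ↦ hne (sub_eq_zero.1 (Subtype.ext h0))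
    obtain ⟨y, -, hy0⟩ := hδ.exists_delta_pow j
    obtain ⟨z, rfl⟩ := hsurj y
    refine hy0 ?_
    have h' : delta δ ^ j * (delta δ * x - 1) = 0 := by
      rw [mul_sub, ← mul_assoc, ← pow_succ, h, mul_one, sub_self]
    exact congr_arg (fun P : diffOpRing δ ↦ P.1 z) h'
  have hx' : ∀ y, δ (x.1 y) = y := fun y ↦ congr_arg (fun P : diffOpRing δ ↦ P.1 y) hx
  have hx0 : x.1 ≠ 0 := fun h0 ↦ one_ne_zero (α := k) (by rw [← hx' 1, h0]; simp)
  obtain ⟨m, hm⟩ := exists_mem_orderLT x.2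
  obtain ⟨n, c, hc, v, hv, hxv⟩ := exists_leading_term hm hx0
  cases n with
  | zero =>
    -- here `x` is the multiplication by `c`, and `δ c = 1`, so `δ (c * c) = c` reads `2 * c = c`
    have hxc : ∀ y, x.1 y = c * y := by simp [hxv, eq_zero_of_mem_orderLT_zero hv]
    have h1 : δ c = 1 := by simpa [hxc] using hx' 1
    have h2 := hx' c
    rw [hxc, Derivation.leibniz, h1, smul_eq_mul, mul_one, add_eq_left] at h2
    exact hc h2
  | succ n =>
    obtain ⟨w, hw, hw0⟩ := hδ.exists_ker hc hv
    exact hw0 (by rw [← hx' w, hxv, hw, map_zero])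

end diffOpRing

/-! ### Ultrapowers -/

theorem IsFadelian.ultrapower {R : Type*} [Ring R] (hR : IsFadelian R) (U : Ultrafilter ℕ) :
    IsFadelian (Ultrapower R U) := by
  have := hR.1
  refine ⟨inferInstance, fun x a ha ↦ ?_⟩
  induction x using Filter.Germ.inductionOn with | _ x
  induction a using Filter.Germ.inductionOn with | _ a
  have ha' : ∀ᶠ n in (U : Filter ℕ), a n ≠ 0 :=
    Ultrafilter.eventually_not.2 fun h ↦ ha (Filter.Germ.coe_eq.2 h)
  have key : ∀ n, ∃ p : R × R, a n ≠ 0 → x n = a n * p.1 + p.2 * a n := fun n ↦ by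
    by_cases h : a n = 0
    · exact ⟨0, fun h' ↦ absurd h h'⟩
    · obtain ⟨b, c, hbc⟩ := hR.2 (x n) (a n) h
      exact ⟨(b, c), fun _ ↦ hbc⟩
  choose p hp using key
  exact ⟨((fun n ↦ (p n).1 : ℕ → R) : Filter.Germ _ R), ((fun n ↦ (p n).2 : ℕ → R)),
    Filter.Germ.coe_eq.2 (ha'.mono hp)⟩

section ultraE

variable {k : Type*} [Field k] {δ : Derivation ℤ k k} {U : Ultrafilter ℕ}

theorem exists_mul_ultraE_succ (δ : Derivation ℤ k k) (U : Ultrafilter ℕ) (n : ℕ) :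
    ∃ d : Ultrapower (diffOpRing δ) U,
      ultraE δ U n = d * ultraE δ U (n + 1) ∧ ultraE δ U n = ultraE δ U (n + 1) * d := by
  let e : ℕ → ℕ → diffOpRing δ := fun n m ↦ if m < n then 1 else diffOpRing.delta δ ^ (m - n + 1)
  let d : ℕ → diffOpRing δ := fun m ↦ if m < n then 1 else diffOpRing.delta δ
  have key : ∀ m, e n m = d m * e (n + 1) m ∧ e n m = e (n + 1) m * d m := fun m ↦ by
    rcases lt_trichotomy m n with h | rfl | h
    · simp [d, e, h, h.trans n.lt_succ_self]
    · simp [d, e]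
    · have h1 : ¬ m < n := by omega
      have h2 : ¬ m < n + 1 := by omega
      have h3 : m - n + 1 = m - (n + 1) + 1 + 1 := by omega
      simp only [d, e, h1, h2, if_false, h3, ← pow_succ', ← pow_succ, and_self]
  have h1 : e n = d * e (n + 1) := funext fun m ↦ (key m).1
  have h2 : e n = e (n + 1) * d := funext fun m ↦ (key m).2
  refine ⟨Filter.Germ.ofFun d, ?_, ?_⟩
  · exact congr_arg (Filter.Germ.ofFun (l := U)) h1
  · exact congr_arg (Filter.Germ.ofFun (l := U)) h2

theorem Ultrafilter.eventually_gt_of_ne_pure (U : Ultrafilter ℕ) (hU : ∀ n : ℕ, U ≠ pure n)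
    (n : ℕ) :
    ∀ᶠ m in (U : Filter ℕ), n < m := by
  refine (U.le_cofinite_or_eq_pure.resolve_right fun ⟨n, h⟩ ↦ hU n h) ?_
  rw [Filter.mem_cofinite]
  exact (Set.finite_Iic n).subset fun m hm ↦ not_lt.1 (show ¬ n < m from hm)

theorem mul_ultraE_ne_ultraE_succ (hδ : IsDifferentiallyClosed δ) (hU : ∀ n : ℕ, U ≠ pure n)
    (n : ℕ) (x : Ultrapower (diffOpRing δ) U) : x * ultraE δ U n ≠ ultraE δ U (n + 1) := by
  induction x using Filter.Germ.inductionOn with | _ x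
  intro h
  obtain ⟨m, hm, hnm⟩ := ((Filter.Germ.coe_eq.1 h).and (U.eventually_gt_of_ne_pure hU n)).exists
  have h1 : ¬ m < n := by omega
  have h2 : ¬ m < n + 1 := by omega
  simp only [h1, h2, if_false] at hm
  refine diffOpRing.mul_delta_pow_succ_ne hδ (x m) (m - n) (hm.trans ?_)
  congr 1; omega

theorem ultraE_mul_ne_ultraE_succ (hδ : IsDifferentiallyClosed δ) (hU : ∀ n : ℕ, U ≠ pure n)
    (n : ℕ) (x : Ultrapower (diffOpRing δ) U) : ultraE δ U n * x ≠ ultraE δ U (n + 1) := by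
  induction x using Filter.Germ.inductionOn with | _ x
  intro h
  obtain ⟨m, hm, hnm⟩ := ((Filter.Germ.coe_eq.1 h).and (U.eventually_gt_of_ne_pure hU n)).exists
  have h1 : ¬ m < n := by omega
  have h2 : ¬ m < n + 1 := by omega
  simp only [h1, h2, if_false] at hm
  refine diffOpRing.delta_pow_succ_mul_ne hδ (x m) (m - n) (hm.trans ?_)
  congr 1; omega

theorem strictMono_span_ultraE (hδ : IsDifferentiallyClosed δ) (hU : ∀ n : ℕ, U ≠ pure n) :
    StrictMono fun n : ℕ ↦ Submodule.span (Ultrapower (diffOpRing δ) U) {ultraE δ U n} := by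
  refine strictMono_nat_of_lt_succ fun n ↦ lt_of_le_not_ge ?_ fun h ↦ ?_
  · obtain ⟨d, hd, -⟩ := exists_mul_ultraE_succ δ U n
    rw [Submodule.span_singleton_le_iff_mem, Submodule.mem_span_singleton]
    exact ⟨d, hd.symm⟩
  · rw [Submodule.span_singleton_le_iff_mem, Submodule.mem_span_singleton] at h
    obtain ⟨x, hx⟩ := h
    exact mul_ultraE_ne_ultraE_succ hδ hU n x hx

theorem strictMono_span_mulOpposite_ultraE (hδ : IsDifferentiallyClosed δ)
    (hU : ∀ n : ℕ, U ≠ pure n) :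
    StrictMono fun n : ℕ ↦ Submodule.span (Ultrapower (diffOpRing δ) U)ᵐᵒᵖ {ultraE δ U n} := by
  refine strictMono_nat_of_lt_succ fun n ↦ lt_of_le_not_ge ?_ fun h ↦ ?_
  · obtain ⟨d, -, hd⟩ := exists_mul_ultraE_succ δ U n
    rw [Submodule.span_singleton_le_iff_mem, Submodule.mem_span_singleton]
    exact ⟨MulOpposite.op d, hd.symm⟩
  · rw [Submodule.span_singleton_le_iff_mem, Submodule.mem_span_singleton] at h
    obtain ⟨x, hx⟩ := h
    exact ultraE_mul_ne_ultraE_succ hδ hU n x.unop hx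

end ultraE

theorem IsDifferentiallyClosed.ne_zero {k : Type*} [Field k] {δ : Derivation ℤ k k}
    (hδ : IsDifferentiallyClosed δ) : δ ≠ 0 := fun h ↦ by
  obtain ⟨y, -, hy⟩ := hδ.exists_delta_pow 1
  exact hy (by simp [h])

theorem ultrapower_diffOpRing {k : Type*} [Field k] {δ : Derivation ℤ k k}
    (hδ : IsDifferentiallyClosed δ) {U : Ultrafilter ℕ} (hU : ∀ n : ℕ, U ≠ pure n) :
    IsFadelian (Ultrapower (diffOpRing δ) U) ∧
      ¬ IsLeftNoetherian (Ultrapower (diffOpRing δ) U) ∧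
      ¬ IsRightNoetherian (Ultrapower (diffOpRing δ) U) := by
  refine ⟨(diffOpRing.isFadelian hδ).ultrapower U, fun h ↦ ?_, fun h ↦ ?_⟩
  · have : IsNoetherian (Ultrapower (diffOpRing δ) U) (Ultrapower (diffOpRing δ) U) := h
    exact not_strictMono_of_wellFoundedGT _ (strictMono_span_ultraE hδ hU)
  · have : IsNoetherian (Ultrapower (diffOpRing δ) U)ᵐᵒᵖ (Ultrapower (diffOpRing δ) U) := h
    exact not_strictMono_of_wellFoundedGT _ (strictMono_span_mulOpposite_ultraE hδ hU)

theorem mainTheorem6 :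
    -- there is a fadelian ring that is neither left nor right Noetherian
    (∃ (R : Type) (_ : Ring R), IsFadelian R ∧ ¬ IsLeftNoetherian R ∧ ¬ IsRightNoetherian R) ∧
    -- there is a differentially closed field with a nonzero derivation
    (∃ (k : Type) (_ : Field k) (δ : Derivation ℤ k k), IsDifferentiallyClosed δ ∧ δ ≠ 0) ∧
    -- every nonprincipal ultrapower of `k[δ]`, for every such field, is an example
    (∀ (k : Type*) [Field k] (δ : Derivation ℤ k k), IsDifferentiallyClosed δ → δ ≠ 0 →
      ∀ U : Ultrafilter ℕ, (∀ n : ℕ, U ≠ pure n) →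
        IsFadelian (Ultrapower (diffOpRing δ) U) ∧
        ¬ IsLeftNoetherian (Ultrapower (diffOpRing δ) U) ∧
        ¬ IsRightNoetherian (Ultrapower (diffOpRing δ) U) ∧
        -- the left ideals, and the right ideals, generated by the `e n` strictly increase
        StrictMono (fun n : ℕ =>
          Submodule.span (Ultrapower (diffOpRing δ) U) {ultraE δ U n}) ∧
        StrictMono (fun n : ℕ =>
          Submodule.span (Ultrapower (diffOpRing δ) U)ᵐᵒᵖ {ultraE δ U n})) := by
  obtain ⟨k, _, δ, hδ⟩ := exists_isDifferentiallyClosed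
  refine ⟨⟨Ultrapower (diffOpRing δ) (Filter.hyperfilter ℕ), inferInstance,
    ultrapower_diffOpRing hδ fun n h ↦ ?_⟩, ⟨k, inferInstance, δ, hδ, hδ.ne_zero⟩,
    fun k _ δ hδ _ U hU ↦ ?_⟩
  · have hn : ({n}ᶜ : Set ℕ) ∈ Filter.hyperfilter ℕ :=
      (Set.finite_singleton n).compl_mem_hyperfilter
    rw [h] at hn
    exact (Ultrafilter.mem_pure.1 hn) rfl
  · obtain ⟨h1, h2, h3⟩ := ultrapower_diffOpRing hδ hU
    exact ⟨h1, h2, h3, strictMono_span_ultraE hδ hU, strictMono_span_mulOpposite_ultraE hδ hU⟩
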